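/- For $n\ge 0$ let $P_n$ be the path on $n$ vertices, and for a finite graph $G$ let $\phi_G(\lambda)$ be the characteristic polynomial of its adjacency matrix (so $\phi_{P_0}=1$) and let the spectral radius $\rho(G)$ be the largest eigenvalue of the adjacency matrix. For real $\lambda\ge 2$ let $x_1\le 1\le x_2$ be the two roots of $x^2-\lambda x+1=0$, and for $m\ge 1$ put $d_m^{(2)}=x_2^{m+2}-\phi_{P_m}(\lambda)$. The open quipu $P^{(m_0,\dots,m_r)}_{(k_0,\dots,k_{r+1})}$ is the tree obtained from a path containing vertices $b_0,\dots,b_r$, in this order, with exactly $k_i$ vertices strictly between $b_{i-1}$ and $b_i$ ($1\le i\le r$), $k_0$ vertices before $b_0$ and $k_{r+1}$ vertices after $b_r$, by attaching a pendent path with $m_i$ edges at each $b_i$. The closed quipu $C^{(m_1,\dots,m_r)}_{(k_1,\dots,k_r)}$ is obtained from a cycle of length $\sum_{i=1}^r (k_i+1)$ containing vertices $b_1,\dots,b_r$ in cyclic order, with exactly $k_i$ vertices strictly between $b_i$ and the next one (for $r=1$: on the cycle besides $b_1$), by attaching a pendent path with $m_i$ edges at each $b_i$. Let $$P_{m,k,r}=P^{(m+1,m,\dots,m,m+1)}_{(m+1,k-1,k,\dots,k,k-1,m+1)}\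 (r\ge 2),\qquad P_{m,k,1}=P^{(m+1,m+1)}_{(m+1,k-2,m+1)}\ (k\ge 2),\qquad C_{m,k,r}=C^{(m,\dots,m)}_{(k,\dots,k)},$$ each having $r$ internal paths. **Lemma.** Let $m,k\ge 1$ be integers. The equation $$d_m^{(2)}=\frac{2\,\phi_{P_{m-1}}(\lambda)\,x_1^{k}}{1-x_1^{k+1}}$$ has a largest root $\rho_{m,k}$ in $\lambda>2$, and 1. $\rho(P_{m,k,r})=\rho_{m,k}$ for every integer $r\ge 1$, except for $r=k=1$; 2. if $k\ge 2$, then $\rho(C_{m,k,r})=\rho_{m,k}$ for every integer $r\ge 1$. In particular these spectral radii do not depend on $r$. -/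

import Mathlib

noncomputable section

/-- The spectral radius of a finite graph `G`, as a relation: `ρ` is the largest eigenvalue of the
adjacency matrix of `G`. -/
def IsGraphSpectralRadius {V : Type*} [Fintype V] (G : SimpleGraph V) (ρ : ℝ) : Prop :=
  open Classical in
  IsGreatest {μ : ℝ | Module.End.HasEigenvalue (Matrix.toLin' (G.adjMatrix ℝ)) μ} ρ

/-- The graph obtained from `H` by attaching, to every vertex `v`, a pendent path with `l v` edges.
The vertex `⟨v, 0⟩` is the vertex `v` of `H`; the vertices `⟨v, 1⟩, …, ⟨v, l v⟩` are the new
vertices of the path attached at `v`, ordered by their distance from `v`. -/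
def attachPaths {V : Type*} (H : SimpleGraph V) (l : V → ℕ) :
    SimpleGraph (Σ v : V, Fin (l v + 1)) where
  Adj a b :=
    (H.Adj a.1 b.1 ∧ a.2.val = 0 ∧ b.2.val = 0) ∨
    (a.1 = b.1 ∧ (a.2.val + 1 = b.2.val ∨ b.2.val + 1 = a.2.val))
  symm := ⟨by
    rintro a b (⟨h, ha, hb⟩ | ⟨h, hab⟩)
    · exact Or.inl ⟨h.symm, hb, ha⟩
    · exact Or.inr ⟨h.symm, hab.symm⟩⟩
  loopless := ⟨by
    rintro a (⟨h, -, -⟩ | ⟨-, h⟩)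
    · exact H.loopless.irrefl _ h
    · omega⟩

/-- Pendent-path lengths along a spine: the spine vertex at position `pos i` (for `i < n`) gets
a pendent path of length `m i`, all other spine vertices get none. -/
def pendentLength (n : ℕ) (pos m : ℕ → ℕ) (p : ℕ) : ℕ :=
  ∑ i ∈ Finset.range n, if p = pos i then m i else 0

/-- Number of spine vertices of the open quipu `P_{(k₀,…,k_{r+1})}^{(m₀,…,m_r)}`: the `r + 1`
branching vertices and the `k₀ + k₁ + ⋯ + k_{r+1}` others. -/
def openSpine (r : ℕ) (k : ℕ → ℕ) : ℕ :=
  (r + 1) + ∑ j ∈ Finset.range (r + 2), k j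

/-- Position on the spine of the `i`-th branching vertex of an open quipu: it is preceded by `i`
branching vertices and by `k₀ + ⋯ + k_i` others. -/
def openPos (k : ℕ → ℕ) (i : ℕ) : ℕ :=
  i + ∑ j ∈ Finset.range (i + 1), k j

/-- Pendent-path lengths along the spine of the open quipu. -/
def openLength (r : ℕ) (k m : ℕ → ℕ) (p : Fin (openSpine r k)) : ℕ :=
  pendentLength (r + 1) (openPos k) m p

/-- The open quipu `P_{(k₀,…,k_{r+1})}^{(m₀,…,m_r)}`: `r` internal paths with `k₁, …, k_r`
internal vertices, joining consecutive branching vertices `b₀, …, b_r`; a pendent path of length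
`m i` at each `b_i`, and further pendent paths of lengths `k₀` at `b₀` and `k_{r+1}` at `b_r`. -/
def openQuipu (r : ℕ) (k m : ℕ → ℕ) :
    SimpleGraph (Σ p : Fin (openSpine r k), Fin (openLength r k m p + 1)) :=
  attachPaths (SimpleGraph.pathGraph (openSpine r k)) (openLength r k m)

/-- Length of the cycle of a closed quipu. -/
def closedSpine (r : ℕ) (k : ℕ → ℕ) : ℕ :=
  ∑ j ∈ Finset.range r, (k j + 1)

/-- Position on the cycle of the `i`-th branching vertex of a closed quipu. -/
def closedPos (k : ℕ → ℕ) (i : ℕ) : ℕ :=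
  ∑ j ∈ Finset.range i, (k j + 1)

/-- Pendent-path lengths along the cycle of the closed quipu. -/
def closedLength (r : ℕ) (k m : ℕ → ℕ) (p : Fin (closedSpine r k)) : ℕ :=
  pendentLength r (closedPos k) m p

/-- The closed quipu with `r` internal paths having `k 0, …, k (r - 1)` internal vertices
and `r` pendent paths of lengths `m 0, …, m (r - 1)`, in cyclic order (a simple graph of this
shape exists when its cycle has at least three vertices). -/
def closedQuipu (r : ℕ) (k m : ℕ → ℕ) :
    SimpleGraph (Σ p : Fin (closedSpine r k), Fin (closedLength r k m p + 1)) :=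
  attachPaths (SimpleGraph.cycleGraph (closedSpine r k)) (closedLength r k m)

/-- The parameters `k₀, …, k_{r+1}` of `P_{m,k,r}`: `(m+1, k-2, m+1)` if `r = 1` and
`(m+1, k-1, k, …, k, k-1, m+1)` if `r ≥ 2`. -/
def specialK (m k r i : ℕ) : ℕ :=
  if i = 0 ∨ i = r + 1 then m + 1
  else if r = 1 then k - 2
  else if i = 1 ∨ i = r then k - 1
  else k

/-- The parameters `m₀, …, m_r` of `P_{m,k,r}`: `(m+1, m, …, m, m+1)`. -/
def specialM (m r i : ℕ) : ℕ :=
  if i = 0 ∨ i = r then m + 1 else m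

/-- The open quipu `P_{m,k,r}`. -/
abbrev specialOpenQuipu (m k r : ℕ) := openQuipu r (specialK m k r) (specialM m r)

/-- The closed quipu `C_{m,k,r} = C_{(k,…,k)}^{(m,…,m)}`. -/
abbrev specialClosedQuipu (m k r : ℕ) := closedQuipu r (fun _ => k) (fun _ => m)

/-- The smaller root `x₁` of `x² - t x + 1 = 0` (for `t ≥ 2`). -/
def xOne (t : ℝ) : ℝ := (t - √(t ^ 2 - 4)) / 2

/-- The larger root `x₂` of `x² - t x + 1 = 0` (for `t ≥ 2`). -/
def xTwo (t : ℝ) : ℝ := (t + √(t ^ 2 - 4)) / 2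

/-- `φ_{P_n}(t)`: the value at `t` of the characteristic polynomial of the path on `n` vertices
(for `n = 0` it is `1`). -/
def phiPath (n : ℕ) (t : ℝ) : ℝ :=
  open Classical in ((SimpleGraph.pathGraph n).adjMatrix ℝ).charpoly.eval t

/-- `d_m^{(2)} = x₂^{m+2} - φ_{P_m}`. -/
def dTwo (m : ℕ) (t : ℝ) : ℝ := xTwo t ^ (m + 2) - phiPath m t

/-- The solutions `t > 2` of `d_m^{(2)} = 2 φ_{P_{m-1}} x₁^k / (1 - x₁^{k+1})`; for `t > 2` one has
`0 < x₁ < 1`, so that the denominator does not vanish. -/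
def quipuRoots (m k : ℕ) : Set ℝ :=
  {t : ℝ | 2 < t ∧
    dTwo m t = 2 * phiPath (m - 1) t * xOne t ^ k / (1 - xOne t ^ (k + 1))}

end

/-! ### Spectral radius from a positive eigenvector. -/

section SpectralRadius

/-! Write `t = x + x⁻¹` with `x > 1`. A positive eigenvector of the adjacency matrix belongs to the
largest eigenvalue (`isGraphSpectralRadius_of_pos`), so it suffices to write down a positive
eigenvector of each quipu whenever `t` solves the equation.

Along a path, eigenvectors combine `x ^ j` and `x⁻¹ ^ j`. On a pendent path the entries are a
multiple of `powDiff`, which vanishes one step beyond the leaf. On an internal path with `k` inner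
vertices the entry at distance `d` from one end is `x ^ d + x ^ (k + 1 - d)`. This is symmetric, so
equal internal paths fit together into one periodic sequence, however many there are. Only the
equations at the branching vertices remain, and each becomes `powDiff x (m + 2) * (1 + x ^ (k + 1))
= 2 * (x + x ^ k) * powDiff x (m + 1)`, the given equation with denominators cleared
(`powDiff_of_mem_quipuRoots`). This is `internalValue_branch`, and it settles the closed quipus.

In the open quipu the end branching vertex sits one step inside a period. The two pendent paths of
length `m + 1` there must together contribute what the missing vertex of the periodic sequence
would; this is the same equation again (`openValue_first`).

A root exists by the intermediate value theorem. It is the largest because every root is the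
spectral radius of the one graph `specialOpenQuipu m k 2`, so there is only one root. -/

theorem IsGraphSpectralRadius.unique {V : Type*} [Fintype V] {G : SimpleGraph V} {ρ σ : ℝ}
    (hρ : IsGraphSpectralRadius G ρ) (hσ : IsGraphSpectralRadius G σ) : ρ = σ :=
  IsGreatest.unique hρ hσ

/-- A positive eigenvector of the adjacency matrix belongs to the largest eigenvalue. -/
theorem isGraphSpectralRadius_of_pos {V : Type*} [Fintype V] [Nonempty V] (G : SimpleGraph V)
    (v : V → ℝ) (t : ℝ) (hv : ∀ a, 0 < v a)
    (h : open Classical in ∀ a, ∑ b, (if G.Adj a b then v b else 0) = t * v a) :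
    IsGraphSpectralRadius G t := by
  classical
  have key : ∀ (w : V → ℝ) (a : V), ((G.adjMatrix ℝ).mulVec w) a
      = ∑ b, (if G.Adj a b then w b else 0) := by
    intro w a
    simp [Matrix.mulVec, dotProduct, SimpleGraph.adjMatrix_apply]
  unfold IsGraphSpectralRadius
  refine ⟨?_, ?_⟩
  · refine Module.End.hasEigenvalue_of_hasEigenvector (x := v) ⟨?_, ?_⟩
    · rw [Module.End.mem_eigenspace_iff, Matrix.toLin'_apply]
      funext a
      have := key v a
      simp only [Pi.smul_apply, smul_eq_mul]
      rw [← h a]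
      convert this
    · intro h0
      obtain ⟨a⟩ := ‹Nonempty V›
      have := hv a
      rw [h0] at this
      simp at this
  · rintro μ hμ
    obtain ⟨w, hw⟩ := hμ.exists_hasEigenvector
    have hw1 : ∀ a, ∑ b, (if G.Adj a b then w b else 0) = μ * w a := by
      intro a
      have h1 := hw.apply_eq_smul
      rw [Matrix.toLin'_apply] at h1
      have h2 := congrFun h1 a
      rw [← key w a]
      simpa using h2
    -- Perron-type comparison: scale `v` by the least `c` with `|w| ≤ c * v`; the eigenvalue
    -- equation at a vertex where equality holds gives `|μ| ≤ t`.
    obtain ⟨a, -, ha⟩ := Finset.exists_max_image Finset.univ (fun a => |w a| / v a)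
      Finset.univ_nonempty
    set c := |w a| / v a with hc
    have hle : ∀ b, |w b| ≤ c * v b := fun b => by
      have := ha b (Finset.mem_univ b)
      exact (div_le_iff₀ (hv b)).1 this
    have hca : |w a| = c * v a := by rw [hc, div_mul_cancel₀ _ (hv a).ne']
    have hcpos : 0 < c := by
      rcases (div_nonneg (abs_nonneg (w a)) (hv a).le).lt_or_eq with h0 | h0
      · exact h0
      · exfalso
        apply hw.2
        funext b
        have := hle b
        rw [hc, ← h0, zero_mul] at this
        exact abs_nonpos_iff.1 this
    have h3 : |μ| * |w a| ≤ t * |w a| := by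
      calc |μ| * |w a| = |∑ b, (if G.Adj a b then w b else 0)| := by rw [hw1, abs_mul]
        _ ≤ ∑ b, |if G.Adj a b then w b else 0| := Finset.abs_sum_le_sum_abs _ _
        _ ≤ ∑ b, c * (if G.Adj a b then v b else 0) := by
            refine Finset.sum_le_sum fun b _ => ?_
            split_ifs
            · exact hle b
            · simp
        _ = t * |w a| := by
            rw [← Finset.mul_sum, h a, hca]; ring
    have h4 : 0 < |w a| := by rw [hca]; exact mul_pos hcpos (hv a)
    exact (le_abs_self μ).trans (le_of_mul_le_mul_right h3 h4)

end SpectralRadius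

/-! ### Neighbour sums in paths and cycles. -/

section PathSums

/-- Sum over the neighbours of `j` in a path with `n` vertices. -/
theorem sum_fin_path_neighbors (n j : ℕ) (f : ℕ → ℝ) (hj : j < n) :
    ∑ i : Fin n, (if i.val + 1 = j ∨ j + 1 = i.val then f i.val else 0)
      = (if j = 0 then 0 else f (j - 1)) + (if j + 1 = n then 0 else f (j + 1)) := by
  rw [Fin.sum_univ_eq_sum_range (fun i => if i + 1 = j ∨ j + 1 = i then f i else 0) n]
  have h1 : ∀ i ∈ Finset.range n, (if i + 1 = j ∨ j + 1 = i then f i else 0)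
      = (if i = j - 1 then (if j = 0 then 0 else f (j - 1)) else 0)
        + (if i = j + 1 then f (j + 1) else 0) := by
    intro i _
    by_cases h0 : i = j + 1
    · subst h0; simp; intros; omega
    · rcases j with _ | j
      · grind
      · grind
  rw [Finset.sum_congr rfl h1, Finset.sum_add_distrib, Finset.sum_ite_eq', Finset.sum_ite_eq',
    if_pos (Finset.mem_range.2 (by omega))]
  congr 1
  by_cases h : j + 1 = n
  · simp [h]
  · rw [if_pos (Finset.mem_range.2 (by omega)), if_neg h]

/-- The index shift makes room for virtual vertices `0` and `n + 1` with value zero, so that the two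
ends need no separate treatment. -/
theorem sum_adj_pathGraph (n : ℕ) (p : Fin n) (S : ℕ → ℝ) (h0 : S 0 = 0) (hn : S (n + 1) = 0)
    [DecidableRel (SimpleGraph.pathGraph n).Adj] :
    ∑ w : Fin n, (if (SimpleGraph.pathGraph n).Adj p w then S (w.val + 1) else 0)
      = S p.val + S (p.val + 2) := by
  have h1 := sum_fin_path_neighbors n p.val (fun i => S (i + 1)) p.2
  have h2 : ∀ w : Fin n, (if (SimpleGraph.pathGraph n).Adj p w then S (w.val + 1) else 0)
      = (if w.val + 1 = p.val ∨ p.val + 1 = w.val then S (w.val + 1) else 0) := by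
    intro w
    simp only [SimpleGraph.pathGraph_adj, or_comm]
  rw [Finset.sum_congr rfl fun w _ => h2 w, h1]
  congr 1
  · split_ifs with h
    · rw [h, h0]
    · congr 1; omega
  · split_ifs with h
    · rw [← hn]; congr 1; omega
    · rfl

/-- Periodicity replaces the wrap-around, and `p + n - 1` stands for the predecessor, avoiding
truncated subtraction at `p = 0`. With fewer than three vertices the two neighbours would not be
distinct. -/
theorem sum_adj_cycleGraph (n : ℕ) (hn : 3 ≤ n) (p : Fin n) (S : ℕ → ℝ)
    (hS : ∀ i, S (i + n) = S i) [DecidableRel (SimpleGraph.cycleGraph n).Adj] :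
    ∑ w : Fin n, (if (SimpleGraph.cycleGraph n).Adj p w then S w.val else 0)
      = S (p.val + n - 1) + S (p.val + 1) := by
  obtain ⟨n, rfl⟩ := Nat.exists_eq_add_of_le' hn
  have hmod : ∀ i, S (i % (n + 3)) = S i := fun i =>
    Function.Periodic.map_mod_nat (f := S) hS i
  have h2 : ∀ w : Fin (n + 3), (if (SimpleGraph.cycleGraph (n + 3)).Adj p w then S w.val else 0)
      = (if w = p - 1 then S w.val else 0) + (if w = p + 1 then S w.val else 0) := by
    intro w
    have hiff : (SimpleGraph.cycleGraph (n + 3)).Adj p w ↔ (w = p - 1 ∨ w = p + 1) := by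
      rw [SimpleGraph.cycleGraph_adj]
      constructor
      · rintro (h | h)
        · left; rw [← h]; abel
        · right; rw [← h]; abel
      · rintro (h | h)
        · left; rw [h]; abel
        · right; rw [h]; abel
    have hne : p - 1 ≠ p + 1 := by
      intro h
      have h3 : (1 : Fin (n + 3)) + 1 = 0 := by
        have := congrArg (fun z => z - p + 1) h
        have e1 : p - 1 - p + 1 = 0 := by abel
        have e2 : p + 1 - p + 1 = (1 : Fin (n + 3)) + 1 := by abel
        rw [e1, e2] at this
        exact this.symm
      have := congrArg Fin.val h3
      simp [Fin.val_add, Nat.mod_eq_of_lt] at this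
    by_cases ha : w = p - 1
    · subst ha
      simp [hiff, hne]
    · by_cases hb : w = p + 1
      · subst hb; simp [hiff, ha]
      · simp [hiff, ha, hb]
  rw [Finset.sum_congr rfl fun w _ => h2 w, Finset.sum_add_distrib, Finset.sum_ite_eq',
    Finset.sum_ite_eq', if_pos (Finset.mem_univ _), if_pos (Finset.mem_univ _)]
  congr 1
  · rw [Fin.val_sub, hmod]
    congr 1
    simp [Nat.mod_eq_of_lt]
    omega
  · rw [Fin.val_add, hmod]
    simp [Nat.mod_eq_of_lt]

end PathSums

/-! ### Characteristic polynomials of paths. -/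

section PathPolynomial

theorem phiPath_eq_det (n : ℕ) (t : ℝ) :
    phiPath n t = (Matrix.of fun i j : Fin n =>
      if i = j then t else if i.val + 1 = j.val ∨ j.val + 1 = i.val then -1 else 0).det := by
  classical
  rw [phiPath, Matrix.eval_charpoly]
  congr 1
  ext i j
  by_cases h : i = j
  · subst h; simp
  · simp only [Matrix.sub_apply, Matrix.scalar_apply, Matrix.diagonal_apply_ne _ h,
      SimpleGraph.adjMatrix_apply, SimpleGraph.pathGraph_adj, Matrix.of_apply, if_neg h]
    split_ifs <;> simp

theorem phiPath_zero (t : ℝ) : phiPath 0 t = 1 := by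
  rw [phiPath_eq_det]; simp

theorem phiPath_one (t : ℝ) : phiPath 1 t = t := by
  rw [phiPath_eq_det]; simp

/-- Laplace expansion along the first row, then along the first column of the second minor. -/
theorem phiPath_add_two (n : ℕ) (t : ℝ) :
    phiPath (n + 2) t = t * phiPath (n + 1) t - phiPath n t := by
  simp only [phiPath_eq_det]
  rw [Matrix.det_succ_row_zero, Fin.sum_univ_succ, Fin.sum_univ_succ,
    Finset.sum_eq_zero (fun i _ => by simp [Fin.ext_iff])]
  have h1 : (Matrix.of fun i j : Fin (n + 2) => if i = j then t
      else if i.val + 1 = j.val ∨ j.val + 1 = i.val then (-1 : ℝ) else 0).submatrix Fin.succ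
      (Fin.succAbove 0) = Matrix.of fun i j : Fin (n + 1) => if i = j then t
      else if i.val + 1 = j.val ∨ j.val + 1 = i.val then (-1 : ℝ) else 0 := by
    ext i j
    simp
  have h2 : ((Matrix.of fun i j : Fin (n + 2) => if i = j then t
      else if i.val + 1 = j.val ∨ j.val + 1 = i.val then (-1 : ℝ) else 0).submatrix Fin.succ
      (Fin.succAbove (Fin.succ 0))).det = - (Matrix.of fun i j : Fin n => if i = j then t
      else if i.val + 1 = j.val ∨ j.val + 1 = i.val then (-1 : ℝ) else 0).det := by
    rw [Matrix.det_succ_column_zero, Fin.sum_univ_succ,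
      Finset.sum_eq_zero (fun i _ => by simp [Fin.ext_iff])]
    have h3 : ((Matrix.of fun i j : Fin (n + 2) => if i = j then t
      else if i.val + 1 = j.val ∨ j.val + 1 = i.val then (-1 : ℝ) else 0).submatrix Fin.succ
      (Fin.succAbove (Fin.succ 0))).submatrix (Fin.succAbove 0) Fin.succ =
      Matrix.of fun i j : Fin n => if i = j then t
      else if i.val + 1 = j.val ∨ j.val + 1 = i.val then (-1 : ℝ) else 0 := by
      ext i j
      simp [Fin.ext_iff]
    rw [h3]
    simp [Fin.ext_iff]
  rw [h1, h2]
  simp [Fin.ext_iff]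
  ring

theorem continuous_phiPath (n : ℕ) : Continuous (phiPath n) := by
  unfold phiPath
  exact Polynomial.continuous _

theorem phiPath_two (n : ℕ) : phiPath n 2 = n + 1 := by
  induction n using Nat.twoStepInduction with
  | zero => simp [phiPath_zero]
  | one => norm_num [phiPath_one]
  | more n h1 h2 => rw [phiPath_add_two, h1, h2]; push_cast; ring

/-- The sequence `xⁿ - x⁻ⁿ`, a multiple of the characteristic polynomials of paths at
`t = x + x⁻¹`. -/
noncomputable def powDiff (x : ℝ) (n : ℕ) : ℝ := x ^ n - x⁻¹ ^ n

theorem powDiff_zero (x : ℝ) : powDiff x 0 = 0 := by simp [powDiff]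

theorem powDiff_add_two {x : ℝ} (hx : x ≠ 0) (n : ℕ) :
    powDiff x n + powDiff x (n + 2) = (x + x⁻¹) * powDiff x (n + 1) := by
  have h : x⁻¹ * x = 1 := inv_mul_cancel₀ hx
  simp only [powDiff, pow_succ]
  linear_combination (x⁻¹ ^ n - x ^ n) * h

theorem powDiff_pos {x : ℝ} (hx : 1 < x) {n : ℕ} (hn : n ≠ 0) : 0 < powDiff x n := by
  have h1 : 1 < x ^ n := one_lt_pow₀ hx hn
  have h2 : x⁻¹ ^ n < 1 := pow_lt_one₀ (by positivity) (inv_lt_one_of_one_lt₀ hx) hn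
  unfold powDiff; linarith

theorem phiPath_mul_powDiff {x : ℝ} (hx : x ≠ 0) (n : ℕ) :
    phiPath n (x + x⁻¹) * powDiff x 1 = powDiff x (n + 1) := by
  induction n using Nat.twoStepInduction with
  | zero => simp [phiPath_zero]
  | one =>
    have := powDiff_add_two hx 0
    rw [powDiff_zero] at this
    rw [phiPath_one]; linarith
  | more n h1 h2 =>
    have := powDiff_add_two hx (n + 1)
    rw [phiPath_add_two]
    linear_combination (x + x⁻¹) * h2 - h1 - this

end PathPolynomial

/-! ### The defining equation in the variable `x`, and existence of a root. -/

section Roots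

theorem xTwo_add_inv {x : ℝ} (hx : 1 < x) : xTwo (x + x⁻¹) = x := by
  have hx0 : x ≠ 0 := by positivity
  have h1 : (x + x⁻¹) ^ 2 - 4 = (x - x⁻¹) ^ 2 := by field_simp; ring
  have h2 : x⁻¹ < 1 := inv_lt_one_of_one_lt₀ hx
  rw [xTwo, h1, Real.sqrt_sq (by linarith)]; ring

theorem xOne_add_inv {x : ℝ} (hx : 1 < x) : xOne (x + x⁻¹) = x⁻¹ := by
  have hx0 : x ≠ 0 := by positivity
  have h1 : (x + x⁻¹) ^ 2 - 4 = (x - x⁻¹) ^ 2 := by field_simp; ring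
  have h2 : x⁻¹ < 1 := inv_lt_one_of_one_lt₀ hx
  rw [xOne, h1, Real.sqrt_sq (by linarith)]; ring

theorem exists_eq_add_inv {t : ℝ} (ht : 2 < t) : ∃ x : ℝ, 1 < x ∧ t = x + x⁻¹ := by
  have h0 : 0 < t ^ 2 - 4 := by nlinarith
  have h1 := Real.sq_sqrt h0.le
  have h2 := Real.sqrt_pos.2 h0
  refine ⟨xTwo t, ?_, ?_⟩
  · unfold xTwo; linarith
  · have h3 : xTwo t ≠ 0 := by unfold xTwo; positivity
    have h4 : xTwo t * (t - xTwo t) = 1 := by unfold xTwo; linarith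
    field_simp
    linarith

theorem two_lt_add_inv {x : ℝ} (hx : 1 < x) : 2 < x + x⁻¹ := by
  have hx0 : 0 < x := by positivity
  have : x + x⁻¹ - 2 = (x - 1) ^ 2 / x := by field_simp; ring
  have h2 : 0 < (x - 1) ^ 2 / x := div_pos (pow_pos (by linarith) 2) hx0
  linarith

/-- The defining equation with denominators cleared. -/
theorem mem_quipuRoots_iff {m k : ℕ} {x : ℝ} (hx : 1 < x) :
    x + x⁻¹ ∈ quipuRoots m k ↔
      (x ^ (m + 2) - phiPath m (x + x⁻¹)) * (x ^ (k + 1) - 1)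
        = 2 * x * phiPath (m - 1) (x + x⁻¹) := by
  have hx0 : x ≠ 0 := by positivity
  have h1 : 1 < x ^ (k + 1) := one_lt_pow₀ hx (by omega)
  have h1' : x ^ (k + 1) - 1 ≠ 0 := by linarith
  have h2 : x⁻¹ ^ k / (1 - x⁻¹ ^ (k + 1)) = x / (x ^ (k + 1) - 1) := by
    have h3 : 1 - x⁻¹ ^ (k + 1) ≠ 0 := by
      have : x⁻¹ ^ (k + 1) < 1 :=
        pow_lt_one₀ (by positivity) (inv_lt_one_of_one_lt₀ hx) (by omega)
      linarith
    rw [div_eq_div_iff h3 h1']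
    simp only [inv_pow, pow_succ]
    have hk : x ^ k ≠ 0 := pow_ne_zero _ hx0
    field_simp
  simp only [quipuRoots, Set.mem_ofPred_eq, two_lt_add_inv hx, true_and, dTwo, xTwo_add_inv hx,
    xOne_add_inv hx]
  rw [mul_div_assoc, h2, ← mul_div_assoc, eq_div_iff h1']
  constructor <;> intro h <;> rw [h] <;> ring

/-- Multiplying by `powDiff x 1` turns the path polynomials into `powDiff`s; the rest is algebra
modulo `x⁻¹ * x = 1`. The result is the form in which the equation appears at branching vertices. -/
theorem powDiff_of_mem_quipuRoots {m k : ℕ} (hm : 1 ≤ m) {x : ℝ} (hx : 1 < x)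
    (h : x + x⁻¹ ∈ quipuRoots m k) :
    powDiff x (m + 2) * (1 + x ^ (k + 1)) = 2 * (x + x ^ k) * powDiff x (m + 1) := by
  have hx0 : x ≠ 0 := by positivity
  rw [mem_quipuRoots_iff hx] at h
  obtain ⟨m, rfl⟩ := Nat.exists_eq_add_of_le' hm
  rw [Nat.add_sub_cancel] at h
  have h1 := phiPath_mul_powDiff hx0 (m + 1)
  have h2 := phiPath_mul_powDiff hx0 m
  have h3 : (x ^ (m + 1 + 2) * powDiff x 1 - powDiff x (m + 1 + 1)) * (x ^ (k + 1) - 1)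
      = 2 * x * powDiff x (m + 1) := by
    rw [← h1, ← h2]; linear_combination powDiff x 1 * h
  have hinv : x⁻¹ * x = 1 := inv_mul_cancel₀ hx0
  refine mul_left_cancel₀ hx0 ?_
  unfold powDiff at *
  generalize x⁻¹ = y at *
  simp only [pow_succ, pow_zero, one_mul] at *
  generalize x ^ m = a at *
  generalize y ^ m = b at *
  generalize x ^ k = c at *
  clear h h1 h2 hx
  grind

/-- The cleared equation changes sign on `(1, 2)`. At `x = 1` the factor `x ^ (k + 1) - 1` vanishes
and the other term is negative. At `x = 2` the bound `powDiff 2 n < 2 ^ n` and `2 ^ (k + 1) ≥ 4`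
give positivity. -/
theorem quipuRoots_nonempty {m k : ℕ} (hm : 1 ≤ m) (hk : 1 ≤ k) : (quipuRoots m k).Nonempty := by
  obtain ⟨m, rfl⟩ := Nat.exists_eq_add_of_le' hm
  set G : ℝ → ℝ := fun x => (x ^ (m + 1 + 2) - phiPath (m + 1) (x + x⁻¹)) * (x ^ (k + 1) - 1)
        - 2 * x * phiPath m (x + x⁻¹) with hG
  have hinv : ContinuousOn (fun x : ℝ => x + x⁻¹) (Set.Icc 1 2) :=
    continuousOn_id.add (continuousOn_inv₀.mono fun x hx => by
      have := hx.1
      simp only [Set.mem_compl_iff, Set.mem_singleton_iff]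
      linarith)
  have hcont : ContinuousOn G (Set.Icc 1 2) := by
    have c1 := (continuous_phiPath (m + 1)).comp_continuousOn hinv
    have c2 := (continuous_phiPath m).comp_continuousOn hinv
    simp only [Function.comp_def] at c1 c2
    exact ((((continuous_pow _).continuousOn).sub c1).mul
      (by fun_prop)).sub ((by fun_prop : ContinuousOn (fun x : ℝ => 2 * x) _).mul c2)
  have h1 : G 1 < 0 := by
    have : (1 : ℝ) + 1⁻¹ = 2 := by norm_num
    simp only [hG, this, phiPath_two, one_pow]
    have : (0 : ℝ) ≤ m := Nat.cast_nonneg m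
    linarith
  have h2 : 0 < G 2 := by
    have e1 := phiPath_mul_powDiff (two_ne_zero (α := ℝ)) (m + 1)
    have e2 := phiPath_mul_powDiff (two_ne_zero (α := ℝ)) m
    have p1 : powDiff 2 1 = 3 / 2 := by norm_num [powDiff]
    have b : ∀ n, powDiff 2 n < 2 ^ n := fun n => by
      unfold powDiff
      have : (0 : ℝ) < 2⁻¹ ^ n := by positivity
      linarith
    have b1 := b (m + 1 + 1)
    have b2 := b (m + 1)
    rw [p1] at e1 e2
    have hk3 : (4 : ℝ) ≤ 2 ^ (k + 1) := by
      have : (2 : ℝ) ^ 2 ≤ 2 ^ (k + 1) := pow_le_pow_right₀ (by norm_num) (by omega)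
      linarith
    have ha : (0 : ℝ) < 2 ^ m := by positivity
    simp only [hG]
    generalize phiPath (m + 1) (2 + 2⁻¹) = A at *
    generalize phiPath m (2 + 2⁻¹) = B at *
    simp only [pow_succ] at *
    have c1 : (2 : ℝ) ^ m * (16 / 3) < 2 ^ m * 2 * 2 * 2 - A := by linarith
    have c2 : B < 2 ^ m * (4 / 3) := by linarith
    have c3 : (2 : ℝ) ^ m * (16 / 3) * 3 ≤ (2 ^ m * 2 * 2 * 2 - A) * (2 ^ k * 2 - 1) :=
      mul_le_mul c1.le (by linarith) (by norm_num) (by linarith)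
    linarith
  obtain ⟨x, hx, h0⟩ := intermediate_value_Ioo (by norm_num : (1 : ℝ) ≤ 2) hcont ⟨h1, h2⟩
  refine ⟨x + x⁻¹, (mem_quipuRoots_iff hx.1).2 ?_⟩
  simp only [hG] at h0
  rw [Nat.add_sub_cancel]
  linarith

end Roots

/-! ### Eliminating the pendent paths. -/

section AttachPaths

/-- A positive solution on the spine extends to a positive eigenvector of the graph with pendent
paths attached. -/
theorem isGraphSpectralRadius_attachPaths {V : Type*} [Fintype V] [Nonempty V]
    (H : SimpleGraph V) [DecidableRel H.Adj] (l : V → ℕ) {x : ℝ} (hx : 1 < x) (s : V → ℝ) (hs : ∀ v, 0 < s v)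
    (h : ∀ v, ∑ w, (if H.Adj v w then s w else 0)
      + s v / powDiff x (l v + 1) * powDiff x (l v) = (x + x⁻¹) * s v) :
    IsGraphSpectralRadius (attachPaths H l) (x + x⁻¹) := by
  classical
  have hx0 : x ≠ 0 := by positivity
  have hpos : ∀ v, 0 < powDiff x (l v + 1) := fun v => powDiff_pos hx (by omega)
  set f : V → ℕ → ℝ := fun v j => s v / powDiff x (l v + 1) * powDiff x (l v + 1 - j) with hf
  have hf0 : ∀ v, f v 0 = s v := fun v => by
    simp only [hf, Nat.sub_zero]
    exact div_mul_cancel₀ _ (hpos v).ne'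
  have : Nonempty (Σ v : V, Fin (l v + 1)) := ⟨⟨Classical.arbitrary V, 0⟩⟩
  refine isGraphSpectralRadius_of_pos _ (fun a => f a.1 a.2.val) _ ?_ ?_
  · rintro ⟨v, j⟩
    exact mul_pos (div_pos (hs v) (hpos v)) (powDiff_pos hx (by have := j.2; simp only; omega))
  · rintro ⟨v, j⟩
    rw [Fintype.sum_sigma]
    have hsplit : ∀ w : V, ∑ i : Fin (l w + 1),
        (if (attachPaths H l).Adj ⟨v, j⟩ ⟨w, i⟩ then f w i.val else 0)
        = (if j.val = 0 then (if H.Adj v w then s w else 0) else 0)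
          + (if w = v then ((if j.val = 0 then 0 else f v (j.val - 1))
            + (if j.val + 1 = l v + 1 then 0 else f v (j.val + 1))) else 0) := by
      intro w
      by_cases hw : w = v
      · subst hw
        rw [if_neg (H.loopless.irrefl w), if_pos rfl, ite_self, zero_add,
          ← sum_fin_path_neighbors (l w + 1) j.val (f w) j.2]
        refine Finset.sum_congr rfl fun i _ => ?_
        have : (attachPaths H l).Adj ⟨w, j⟩ ⟨w, i⟩ ↔ (i.val + 1 = j.val ∨ j.val + 1 = i.val) := by
          simp [attachPaths, or_comm]
        simp only [this]
      · rw [if_neg hw, add_zero, Fin.sum_univ_succ, Finset.sum_eq_zero, add_zero]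
        · simp only [attachPaths, Fin.val_zero, hf0, Ne.symm hw, false_and, or_false, and_true]
          rw [← ite_and]
          simp only [and_comm]
        · intro i _
          simp [attachPaths, Ne.symm hw]
    refine (Finset.sum_congr rfl fun w _ => hsplit w).trans ?_
    rw [Finset.sum_add_distrib, Finset.sum_ite_eq', if_pos (Finset.mem_univ _)]
    -- The value one step beyond the leaf is `powDiff x 0 = 0`, so the leaf satisfies the same
    -- recurrence as the other vertices of the path.
    have hend : (if j.val + 1 = l v + 1 then 0 else f v (j.val + 1)) = f v (j.val + 1) := by
      split_ifs with h1
      · simp only [hf, h1, Nat.sub_self, powDiff_zero, mul_zero]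
      · rfl
    rw [hend]
    have hv := h v
    by_cases hj : j.val = 0
    · simp only [hj, if_true, zero_add, hf0]
      rw [← hv]
      simp only [hf, Nat.add_sub_cancel]
    · simp only [if_neg hj, Finset.sum_const_zero, zero_add]
      have hlt := j.2
      have h3 := powDiff_add_two hx0 (l v + 1 - (j.val + 1))
      rw [show l v + 1 - (j.val + 1) + 2 = l v + 1 - (j.val - 1) by omega,
        show l v + 1 - (j.val + 1) + 1 = l v + 1 - j.val by omega] at h3
      simp only [hf]
      linear_combination (s v / powDiff x (l v + 1)) * h3

end AttachPaths

/-! ### Evaluating the pendent lengths. -/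

section Pendent

theorem pendentLength_eq_of_pos {n i p : ℕ} {pos m : ℕ → ℕ} (hi : i < n) (hp : p = pos i)
    (hinj : ∀ j < n, p = pos j → j = i) : pendentLength n pos m p = m i := by
  unfold pendentLength
  rw [Finset.sum_eq_single_of_mem i (Finset.mem_range.2 hi), if_pos hp]
  intro j hj hne
  exact if_neg fun h => hne (hinj j (Finset.mem_range.1 hj) h)

theorem pendentLength_eq_zero {n p : ℕ} {pos m : ℕ → ℕ} (h : ∀ j < n, p ≠ pos j) :
    pendentLength n pos m p = 0 :=
  Finset.sum_eq_zero fun j hj => if_neg (h j (Finset.mem_range.1 hj))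

end Pendent

/-! ### The periodic solution along internal paths. -/

section InternalPaths

/-- The values along a periodic sequence of internal paths with `N - 1` internal vertices. -/
noncomputable def internalValue (x : ℝ) (N q : ℕ) : ℝ := x ^ (q % N) + x ^ (N - q % N)

theorem internalValue_pos {x : ℝ} (hx : 1 < x) (N q : ℕ) : 0 < internalValue x N q := by
  unfold internalValue; positivity

/-- The case `d = N` is included because the two ends of a period carry the same value; a block can
thus be read up to its right end. -/
theorem internalValue_mul_add {x : ℝ} {N : ℕ} (i : ℕ) {d : ℕ} (hd : d ≤ N) :
    internalValue x N (i * N + d) = x ^ d + x ^ (N - d) := by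
  unfold internalValue
  rcases hd.lt_or_eq with h | rfl
  · rw [Nat.add_comm, Nat.add_mul_mod_self_right, Nat.mod_eq_of_lt h]
  · rw [← Nat.succ_mul, Nat.mul_mod_left]
    simp [add_comm]

theorem internalValue_add_two {x : ℝ} (hx : x ≠ 0) {N q : ℕ} (hN : 0 < N) (hq : ¬ N ∣ q + 1) :
    internalValue x N q + internalValue x N (q + 2) = (x + x⁻¹) * internalValue x N (q + 1) := by
  obtain ⟨i, d, hd, rfl⟩ : ∃ i d, d < N ∧ q = i * N + d :=
    ⟨q / N, q % N, Nat.mod_lt _ hN, by rw [mul_comm]; exact (Nat.div_add_mod q N).symm⟩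
  have hd1 : d + 1 ≠ N := by
    rintro rfl
    exact hq ⟨i + 1, by ring⟩
  rw [add_assoc, add_assoc, internalValue_mul_add i hd.le, internalValue_mul_add i (by omega),
    internalValue_mul_add i (by omega)]
  obtain ⟨e, rfl⟩ : ∃ e, N = d + 2 + e := ⟨N - (d + 2), by omega⟩
  rw [show d + 2 + e - d = e + 2 by omega, show d + 2 + e - (d + 2) = e by omega,
    show d + 2 + e - (d + 1) = e + 1 by omega]
  have h : x⁻¹ * x = 1 := inv_mul_cancel₀ hx
  simp only [pow_succ]
  linear_combination (- x ^ d - x ^ e) * h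

/-- Both spine neighbours carry `x + x ^ k` and the branching vertex carries `1 + x ^ (k + 1)`. The
recurrence for `powDiff` absorbs the pendent term, leaving exactly `hE`. -/
theorem internalValue_branch {x : ℝ} {k m : ℕ} (hk : 1 ≤ k) (hx : 1 < x)
    (hE : powDiff x (m + 2) * (1 + x ^ (k + 1)) = 2 * (x + x ^ k) * powDiff x (m + 1)) (i : ℕ) :
    internalValue x (k + 1) (i * (k + 1) + k) + internalValue x (k + 1) (i * (k + 1) + k + 2)
      + internalValue x (k + 1) (i * (k + 1) + k + 1) / powDiff x (m + 1) * powDiff x m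
      = (x + x⁻¹) * internalValue x (k + 1) (i * (k + 1) + k + 1) := by
  have hx0 : x ≠ 0 := by positivity
  have hp := powDiff_pos hx (n := m + 1) (by omega)
  rw [add_assoc (i * (k + 1)) k 1]
  have h1 : i * (k + 1) + k + 2 = (i + 1) * (k + 1) + 1 := by ring
  rw [h1, internalValue_mul_add i (by omega), internalValue_mul_add (i + 1) (by omega), add_assoc,
    internalValue_mul_add i le_rfl, Nat.add_sub_cancel, Nat.add_sub_cancel_left, Nat.sub_self]
  have h2 := powDiff_add_two hx0 m
  field_simp at h2 ⊢
  linear_combination (x ^ (k + 1) + 1) * h2 - x * hE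

end InternalPaths

/-! ### Closed quipus. -/

section Closed

theorem closedPos_const (k i : ℕ) : closedPos (fun _ => k) i = i * (k + 1) := by
  simp [closedPos]

theorem internalValue_closed_spine {m k r n p : ℕ} (hk : 1 ≤ k) (hn : n = r * (k + 1))
    (hp : p < n) {x : ℝ} (hx : 1 < x)
    (hE : powDiff x (m + 2) * (1 + x ^ (k + 1)) = 2 * (x + x ^ k) * powDiff x (m + 1)) :
    internalValue x (k + 1) (p + n - 1) + internalValue x (k + 1) (p + 1)
      + internalValue x (k + 1) p
          / powDiff x (pendentLength r (closedPos fun _ => k) (fun _ => m) p + 1)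
        * powDiff x (pendentLength r (closedPos fun _ => k) (fun _ => m) p)
      = (x + x⁻¹) * internalValue x (k + 1) p := by
  have hx0 : x ≠ 0 := by positivity
  have hper : ∀ q, internalValue x (k + 1) (q + n) = internalValue x (k + 1) q :=
    fun q => by simp only [internalValue, hn, Nat.add_mul_mod_self_right]
  have hdn : k + 1 ∣ n := hn ▸ Dvd.intro_left r rfl
  -- Moving one full turn ahead, from `p` to `p + n = q + 1`, gives position `0` a genuine
  -- predecessor.
  obtain ⟨q, hq⟩ : ∃ q, p + n = q + 1 := ⟨p + n - 1, by omega⟩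
  have e1 : internalValue x (k + 1) p = internalValue x (k + 1) (q + 1) := by
    rw [← hq, hper]
  have e2 : internalValue x (k + 1) (p + 1) = internalValue x (k + 1) (q + 2) := by
    rw [show q + 2 = p + 1 + n by omega, hper]
  rw [hq, Nat.add_sub_cancel, e1, e2]
  by_cases hd : k + 1 ∣ p
  · obtain ⟨c, hc⟩ := (Nat.dvd_add hd hdn)
    obtain ⟨i, hi⟩ := hd
    have hlen : pendentLength r (closedPos fun _ => k) (fun _ => m) p = m := by
      refine pendentLength_eq_of_pos (i := i) ?_ ?_ ?_
      · rw [hn, hi, mul_comm] at hp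
        exact lt_of_mul_lt_mul_right hp (Nat.zero_le _)
      · rw [closedPos_const, hi, mul_comm]
      · intro j _ hj
        rw [closedPos_const, hi, mul_comm] at hj
        exact (Nat.eq_of_mul_eq_mul_right (Nat.succ_pos k) hj).symm
    rw [hlen]
    rcases c with _ | c
    · omega
    · have hqc : q = c * (k + 1) + k := by
        have : (k + 1) * (c + 1) = c * (k + 1) + k + 1 := by ring
        omega
      rw [hqc]
      exact internalValue_branch hk hx hE c
  · have hlen : pendentLength r (closedPos fun _ => k) (fun _ => m) p = 0 := by
      refine pendentLength_eq_zero fun j _ hj => hd ?_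
      rw [hj, closedPos_const]
      exact Dvd.intro_left _ rfl
    rw [hlen, powDiff_zero, mul_zero, add_zero]
    exact internalValue_add_two hx0 (Nat.succ_pos k) fun h => hd
      ((Nat.dvd_add_left hdn).1 (hq ▸ h))

theorem isGraphSpectralRadius_specialClosedQuipu {m k r : ℕ} (hk : 2 ≤ k) (hr : 1 ≤ r) {x : ℝ}
    (hx : 1 < x)
    (hE : powDiff x (m + 2) * (1 + x ^ (k + 1)) = 2 * (x + x ^ k) * powDiff x (m + 1)) :
    IsGraphSpectralRadius (specialClosedQuipu m k r) (x + x⁻¹) := by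
  have hn : closedSpine r (fun _ => k) = r * (k + 1) := by simp [closedSpine]
  have h3 : 3 ≤ closedSpine r (fun _ => k) := by rw [hn]; nlinarith
  have : Nonempty (Fin (closedSpine r (fun _ => k))) := ⟨⟨0, by omega⟩⟩
  refine isGraphSpectralRadius_attachPaths _ _ hx (fun p => internalValue x (k + 1) p.val)
    (fun p => internalValue_pos hx _ _) fun p => ?_
  rw [sum_adj_cycleGraph _ h3 p (internalValue x (k + 1)) fun i => by
    simp only [internalValue, hn, Nat.add_mul_mod_self_right]]
  exact internalValue_closed_spine (by omega) hn p.2 hx hE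

end Closed

/-! ### Open quipus. -/

section Open

theorem sum_specialK {m k r : ℕ} (hr : 2 ≤ r) (hk : 1 ≤ k) {i : ℕ} (hi : 1 ≤ i) (hir : i < r) :
    i + ∑ j ∈ Finset.range (i + 1), specialK m k r j = m + i * (k + 1) := by
  induction i, hi using Nat.le_induction with
  | base =>
    have h0 : specialK m k r 0 = m + 1 := by simp [specialK]
    have h1 : specialK m k r 1 = k - 1 := by
      unfold specialK
      rw [if_neg (by omega), if_neg (by omega), if_pos (by omega)]
    simp only [Finset.sum_range_succ, Finset.sum_range_zero, h0, h1]
    omega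
  | succ i hi ih =>
    have h1 : specialK m k r (i + 1) = k := by
      unfold specialK
      rw [if_neg (by omega), if_neg (by omega), if_neg (by omega)]
    rw [Finset.sum_range_succ, h1]
    have := ih (by omega)
    have h2 : (i + 1) * (k + 1) = i * (k + 1) + k + 1 := by ring
    omega

theorem openPos_special_zero (m k r : ℕ) : openPos (specialK m k r) 0 = m + 1 := by
  simp [openPos, specialK]

theorem openPos_special_inner {m k r : ℕ} (hk : 1 ≤ k) {i : ℕ} (hi : 1 ≤ i) (hir : i < r) :
    openPos (specialK m k r) i = m + i * (k + 1) :=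
  sum_specialK (by omega) hk hi hir

/-- The excluded case `r = k = 1` is the one where `k - 2` truncates and the position formula fails.
-/
theorem openPos_special_last {m k r : ℕ} (hk : 1 ≤ k) (hr : 1 ≤ r) (hrk : ¬ (r = 1 ∧ k = 1)) :
    openPos (specialK m k r) r + 1 = m + r * (k + 1) := by
  unfold openPos
  rcases hr.lt_or_eq with h | rfl
  · obtain ⟨s, rfl⟩ := Nat.exists_eq_add_of_le' hr
    have h1 : specialK m k (s + 1) (s + 1) = k - 1 := by
      unfold specialK
      rw [if_neg (by omega), if_neg (by omega), if_pos (by omega)]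
    have h2 := sum_specialK (m := m) (r := s + 1) h hk (i := s) (by omega) (by omega)
    rw [Finset.sum_range_succ, h1]
    have h3 : (s + 1) * (k + 1) = s * (k + 1) + k + 1 := by ring
    omega
  · have h0 : specialK m k 1 0 = m + 1 := by simp [specialK]
    have h1 : specialK m k 1 1 = k - 2 := by simp [specialK]
    simp only [Finset.sum_range_succ, Finset.sum_range_zero, h0, h1]
    omega

theorem openSpine_special {m k r : ℕ} (hk : 1 ≤ k) (hr : 1 ≤ r) (hrk : ¬ (r = 1 ∧ k = 1)) :
    openSpine r (specialK m k r) = 2 * m + 1 + r * (k + 1) := by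
  have h := openPos_special_last (m := m) hk hr hrk
  unfold openPos at h
  have h1 : specialK m k r (r + 1) = m + 1 := by simp [specialK]
  rw [openSpine, Finset.sum_range_succ, h1]
  omega

/-- A positive solution along the spine of `specialOpenQuipu m k r`, at distance `P` from a
virtual vertex before the spine. -/
noncomputable def openValue (x : ℝ) (m k r P : ℕ) : ℝ :=
  if P ≤ m + 2 then internalValue x (k + 1) 1 / powDiff x (m + 2) * powDiff x P
  else if P ≤ m + r * (k + 1) then internalValue x (k + 1) (P - m - 1)
  else internalValue x (k + 1) 1 / powDiff x (m + 2) * powDiff x (2 * m + 2 + r * (k + 1) - P)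

variable {x : ℝ} {m k r : ℕ}

theorem openValue_left {P : ℕ} (hP : P ≤ m + 2) :
    openValue x m k r P = internalValue x (k + 1) 1 / powDiff x (m + 2) * powDiff x P :=
  if_pos hP

/-- The first branching vertex is `P = m + 2`, that is `q = 1`: the periodic sequence starts one
step inside a period. There the pendent and periodic formulas agree by the normalisation of the
former. -/
theorem openValue_middle (hx : 1 < x) {q : ℕ} (hq : 1 ≤ q) (hqr : q + 1 ≤ r * (k + 1)) :
    openValue x m k r (m + 1 + q) = internalValue x (k + 1) q := by
  unfold openValue
  split_ifs with h1 h2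
  · obtain rfl : q = 1 := by omega
    exact div_mul_cancel₀ _ (powDiff_pos hx (by omega)).ne'
  · congr 1; omega
  · omega

theorem internalValue_symm {x : ℝ} {N q c : ℕ} (hN : 0 < N) (hq : q ≤ c * N) :
    internalValue x N (c * N - q) = internalValue x N q := by
  obtain ⟨i, d, hd, rfl⟩ : ∃ i d, d < N ∧ q = i * N + d :=
    ⟨q / N, q % N, Nat.mod_lt _ hN, by rw [mul_comm]; exact (Nat.div_add_mod q N).symm⟩
  rw [internalValue_mul_add i hd.le]
  have hic : i ≤ c := le_of_mul_le_mul_right (by omega : i * N ≤ c * N) hN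
  obtain ⟨e, rfl⟩ := Nat.exists_eq_add_of_le hic
  rcases e with _ | e
  · obtain rfl : d = 0 := by simpa using hq
    rw [show (i + 0) * N - (i * N + 0) = 0 * N + 0 by simp, internalValue_mul_add 0 (by omega)]
  · rw [show (i + (e + 1)) * N - (i * N + d) = e * N + (N - d) by
      rw [show (i + (e + 1)) * N = i * N + (e * N + N) by ring]; omega,
      internalValue_mul_add e (by omega), Nat.sub_sub_self hd.le, add_comm]

/-- The solution is symmetric under reversal of the spine. -/
theorem openValue_symm (hx : 1 < x) (hr : 3 ≤ r * (k + 1)) {P Q : ℕ}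
    (h : P + Q = 2 * m + 2 + r * (k + 1)) : openValue x m k r P = openValue x m k r Q := by
  have key : ∀ P Q : ℕ, P + Q = 2 * m + 2 + r * (k + 1) → P ≤ Q →
      openValue x m k r P = openValue x m k r Q := by
    intro P Q h hPQ
    by_cases h1 : P ≤ m + 1
    · unfold openValue
      rw [if_pos (by omega), if_neg (by omega), if_neg (by omega)]
      congr 2; omega
    · obtain ⟨q, rfl⟩ := Nat.exists_eq_add_of_le (by omega : m + 1 ≤ P)
      obtain ⟨s, rfl⟩ := Nat.exists_eq_add_of_le (by omega : m + 1 ≤ Q)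
      rw [openValue_middle hx (by omega) (by omega), openValue_middle hx (by omega) (by omega),
        ← internalValue_symm (N := k + 1) (c := r) (Nat.succ_pos k) (by omega : q ≤ r * (k + 1))]
      congr 1; omega
  rcases le_total P Q with h1 | h1
  · exact key P Q h h1
  · exact (key Q P (by omega) h1).symm

theorem openValue_pos (hx : 1 < x) {P : ℕ} (h0 : 1 ≤ P) (hP : P ≤ 2 * m + 1 + r * (k + 1)) :
    0 < openValue x m k r P := by
  have hc : 0 < internalValue x (k + 1) 1 / powDiff x (m + 2) :=
    div_pos (internalValue_pos hx _ _) (powDiff_pos hx (by omega))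
  unfold openValue
  split_ifs
  · exact mul_pos hc (powDiff_pos hx (by omega))
  · exact internalValue_pos hx _ _
  · exact mul_pos hc (powDiff_pos hx (by omega))

/-- The eigenvalue equation at the spine vertices before the first branching
vertex. -/
theorem openValue_outer (hx : 1 < x) {P : ℕ} (hP : P ≤ m) :
    openValue x m k r P + openValue x m k r (P + 2) = (x + x⁻¹) * openValue x m k r (P + 1) := by
  have hx0 : x ≠ 0 := by positivity
  rw [openValue_left (by omega), openValue_left (by omega), openValue_left (by omega)]
  linear_combination (internalValue x (k + 1) 1 / powDiff x (m + 2)) * powDiff_add_two hx0 P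

/-- The periodic sequence would continue to the value `1 + x ^ (k + 1)` at `q = 0`. By `hE` this is
twice the value at the neighbour on a pendent path of length `m + 1`, and there are two such
neighbours: one on the spine, one on the attached path. -/
theorem openValue_first (hx : 1 < x) (hk : 1 ≤ k) (hr : 3 ≤ r * (k + 1))
    (hE : powDiff x (m + 2) * (1 + x ^ (k + 1)) = 2 * (x + x ^ k) * powDiff x (m + 1)) :
    openValue x m k r (m + 1) + openValue x m k r (m + 3)
      + openValue x m k r (m + 2) / powDiff x (m + 1 + 1) * powDiff x (m + 1)
      = (x + x⁻¹) * openValue x m k r (m + 2) := by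
  have hx0 : x ≠ 0 := by positivity
  have hp := powDiff_pos hx (n := m + 2) (by omega)
  rw [openValue_left (by omega), show m + 3 = m + 1 + 2 by omega,
    show m + 2 = m + 1 + 1 by omega, openValue_middle hx (by omega) (by omega),
    openValue_middle hx le_rfl (by omega)]
  have h1 := internalValue_add_two hx0 (N := k + 1) (q := 0) (Nat.succ_pos k)
    (by rw [Nat.dvd_one]; omega)
  have h0 : internalValue x (k + 1) 0 = 1 + x ^ (k + 1) := by
    simp [internalValue]
  have h2 : internalValue x (k + 1) 1 = x + x ^ k := by
    have := internalValue_mul_add (x := x) (N := k + 1) 0 (d := 1) (by omega)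
    simpa using this
  have h3 : internalValue x (k + 1) 0
      = 2 * (internalValue x (k + 1) 1 / powDiff x (m + 1 + 1) * powDiff x (m + 1)) := by
    rw [h0, h2]
    field_simp
    linear_combination hE
  simp only [zero_add] at h1
  linear_combination h1 - h3

/-- The eigenvalue equation along the spine of `specialOpenQuipu m k r`. -/
theorem openValue_spine (hx : 1 < x) (hk : 1 ≤ k) (hr1 : 1 ≤ r) (hrk : ¬ (r = 1 ∧ k = 1))
    (hE : powDiff x (m + 2) * (1 + x ^ (k + 1)) = 2 * (x + x ^ k) * powDiff x (m + 1))
    {p L : ℕ} (hp : p < 2 * m + 1 + r * (k + 1))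
    (hL : L = pendentLength (r + 1) (openPos (specialK m k r)) (specialM m r) p) :
    openValue x m k r p + openValue x m k r (p + 2)
      + openValue x m k r (p + 1) / powDiff x (L + 1) * powDiff x L
      = (x + x⁻¹) * openValue x m k r (p + 1) := by
  have hx0 : x ≠ 0 := by positivity
  have hr : 3 ≤ r * (k + 1) := by
    rcases hr1.lt_or_eq with h | rfl
    · nlinarith
    · omega
  have pos0 := openPos_special_zero m k r
  have posr := openPos_special_last (m := m) hk hr1 hrk
  have posi : ∀ j, 1 ≤ j → j < r → openPos (specialK m k r) j = m + j * (k + 1) :=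
    fun j h1 h2 => openPos_special_inner hk h1 h2
  have hmono : ∀ j, 1 ≤ j → j < r → k + 1 ≤ j * (k + 1) ∧ j * (k + 1) + (k + 1) ≤ r * (k + 1) := by
    intro j h1 h2
    refine ⟨Nat.le_mul_of_pos_left _ h1, ?_⟩
    rw [← Nat.succ_mul]
    exact Nat.mul_le_mul_right _ h2
  have hcases : ∀ j, j < r + 1 → p = openPos (specialK m k r) j →
      (j = 0 ∧ p = m + 1) ∨ (j = r ∧ p + 1 = m + r * (k + 1)) ∨
      (1 ≤ j ∧ j < r ∧ p = m + j * (k + 1)) := by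
    intro j hj hpj
    rcases Nat.eq_zero_or_pos j with rfl | hj0
    · left; exact ⟨rfl, by omega⟩
    · rcases (Nat.lt_succ_iff.1 hj).lt_or_eq with h | rfl
      · right; right; exact ⟨hj0, h, by rw [hpj, posi j hj0 h]⟩
      · right; left; exact ⟨rfl, by omega⟩
  have hzero : (¬ ∃ j, j < r + 1 ∧ p = openPos (specialK m k r) j) →
      openValue x m k r p + openValue x m k r (p + 2) = (x + x⁻¹) * openValue x m k r (p + 1) →
      openValue x m k r p + openValue x m k r (p + 2)
      + openValue x m k r (p + 1) / powDiff x (L + 1) * powDiff x L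
      = (x + x⁻¹) * openValue x m k r (p + 1) := by
    intro h1 h2
    have : L = 0 := hL.trans (pendentLength_eq_zero fun j hj hpj => h1 ⟨j, hj, hpj⟩)
    rw [this, powDiff_zero, mul_zero, add_zero, h2]
  by_cases c1 : p ≤ m
  · refine hzero ?_ (openValue_outer hx c1)
    rintro ⟨j, hj, hpj⟩
    rcases hcases j hj hpj with h | h | ⟨h1, h2, h3⟩
    · omega
    · omega
    · have := hmono j h1 h2
      omega
  by_cases c2 : p = m + 1
  · have : L = m + 1 := by
      refine hL.trans ((pendentLength_eq_of_pos (i := 0) (by omega) (by omega) ?_).trans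
        (by simp [specialM]))
      intro j hj hpj
      rcases hcases j hj hpj with h | h | ⟨h1, h2, h3⟩
      · exact h.1
      · omega
      · have := hmono j h1 h2
        omega
    rw [this, c2]
    exact openValue_first hx hk hr hE
  by_cases c3 : p + 1 = m + r * (k + 1)
  · have : L = m + 1 := by
      refine hL.trans ((pendentLength_eq_of_pos (i := r) (by omega) (by omega) ?_).trans
        (by simp [specialM]))
      intro j hj hpj
      rcases hcases j hj hpj with h | h | ⟨h1, h2, h3⟩
      · omega
      · exact h.1
      · have := hmono j h1 h2
        omega
    -- Reflection of the spine carries the last branching vertex to the first.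
    rw [this, openValue_symm hx hr (Q := m + 3) (by omega : p + _ = _),
      openValue_symm hx hr (Q := m + 1) (by omega : p + 2 + _ = _),
      openValue_symm hx hr (Q := m + 2) (by omega : p + 1 + _ = _)]
    have := openValue_first hx hk hr hE
    linear_combination this
  by_cases c4 : m + r * (k + 1) ≤ p
  · refine hzero ?_ ?_
    · rintro ⟨j, hj, hpj⟩
      rcases hcases j hj hpj with h | h | ⟨h1, h2, h3⟩
      · omega
      · omega
      · have := hmono j h1 h2
        omega
    · obtain ⟨Q, hQ⟩ := Nat.exists_eq_add_of_le (by omega : p ≤ 2 * m + r * (k + 1))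
      rw [openValue_symm hx hr (Q := Q + 2) (by omega : p + _ = _),
        openValue_symm hx hr (Q := Q) (by omega : p + 2 + _ = _),
        openValue_symm hx hr (Q := Q + 1) (by omega : p + 1 + _ = _), add_comm]
      exact openValue_outer hx (by omega)
  obtain ⟨q, rfl⟩ := Nat.exists_eq_add_of_le (by omega : m + 1 ≤ p)
  have hv : ∀ d, d ≤ 2 → openValue x m k r (m + 1 + q + d) = internalValue x (k + 1) (q + d) :=
    fun d hd => by rw [add_assoc, openValue_middle hx (by omega) (by omega)]
  have hv0 := hv 0 (by omega)
  rw [add_zero, add_zero] at hv0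
  -- Strictly between the end branching vertices, the multiples of `k + 1` are the branching
  -- vertices; elsewhere the plain recurrence holds.
  by_cases hd : k + 1 ∣ q + 1
  · obtain ⟨c, hc⟩ := hd
    rw [mul_comm] at hc
    have hc1 : 1 ≤ c := by
      rcases c with _ | c
      · omega
      · omega
    have hcr : c < r := lt_of_mul_lt_mul_right (by omega : c * (k + 1) < r * (k + 1))
      (Nat.zero_le _)
    have : L = m := by
      refine hL.trans ((pendentLength_eq_of_pos (i := c) (by omega) ?_ ?_).trans ?_)
      · rw [posi c hc1 hcr]; omega
      · intro j hj hpj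
        rcases hcases j hj hpj with h | h | ⟨h1, h2, h3⟩
        · omega
        · omega
        · exact Nat.eq_of_mul_eq_mul_right (by omega : 0 < k + 1) (by omega)
      · simp only [specialM]
        rw [if_neg (by omega)]
    rw [this, hv0, hv 2 le_rfl, hv 1 (by omega)]
    obtain ⟨i, rfl⟩ := Nat.exists_eq_add_of_le' hc1
    have hq : q = i * (k + 1) + k := by
      have : (i + 1) * (k + 1) = i * (k + 1) + k + 1 := by ring
      omega
    rw [hq]
    exact internalValue_branch hk hx hE i
  · refine hzero ?_ ?_
    · rintro ⟨j, hj, hpj⟩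
      rcases hcases j hj hpj with h | h | ⟨h1, h2, h3⟩
      · omega
      · omega
      · exact hd ⟨j, by rw [mul_comm]; omega⟩
    · rw [hv0, hv 2 le_rfl, hv 1 (by omega)]
      exact internalValue_add_two hx0 (Nat.succ_pos k) hd

theorem isGraphSpectralRadius_specialOpenQuipu (hx : 1 < x) (hk : 1 ≤ k) (hr : 1 ≤ r)
    (hrk : ¬ (r = 1 ∧ k = 1))
    (hE : powDiff x (m + 2) * (1 + x ^ (k + 1)) = 2 * (x + x ^ k) * powDiff x (m + 1)) :
    IsGraphSpectralRadius (specialOpenQuipu m k r) (x + x⁻¹) := by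
  have hn := openSpine_special (m := m) hk hr hrk
  have : Nonempty (Fin (openSpine r (specialK m k r))) := ⟨⟨0, by omega⟩⟩
  classical
  have h3 : 2 ≤ r * (k + 1) := by nlinarith
  refine isGraphSpectralRadius_attachPaths _ _ hx (fun p => openValue x m k r (p.val + 1))
    (fun p => openValue_pos hx (by omega) (by have := p.2; omega)) fun p => ?_
  rw [sum_adj_pathGraph _ p (openValue x m k r)]
  · exact openValue_spine hx hk hr hrk hE (by have := p.2; omega) rfl
  · rw [openValue_left (by omega), powDiff_zero, mul_zero]
  · rw [hn, openValue, if_neg (by omega), if_neg (by omega)]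
    rw [show 2 * m + 2 + r * (k + 1) - (2 * m + 1 + r * (k + 1) + 1) = 0 by omega, powDiff_zero,
      mul_zero]

end Open

/-! ### The main theorem. -/

theorem mainTheorem6 (m k : ℕ) (hm : 1 ≤ m) (hk : 1 ≤ k) :
    ∃ ρ : ℝ, IsGreatest (quipuRoots m k) ρ ∧
      (∀ r : ℕ, 1 ≤ r → ¬ (r = 1 ∧ k = 1) →
        IsGraphSpectralRadius (specialOpenQuipu m k r) ρ) ∧
      (2 ≤ k → ∀ r : ℕ, 1 ≤ r →
        IsGraphSpectralRadius (specialClosedQuipu m k r) ρ) := by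
  have hopen : ∀ t ∈ quipuRoots m k, ∀ r : ℕ, 1 ≤ r → ¬ (r = 1 ∧ k = 1) →
      IsGraphSpectralRadius (specialOpenQuipu m k r) t := by
    intro t ht r hr hrk
    obtain ⟨x, hx, rfl⟩ := exists_eq_add_inv ht.1
    exact isGraphSpectralRadius_specialOpenQuipu hx hk hr hrk (powDiff_of_mem_quipuRoots hm hx ht)
  obtain ⟨ρ, hρ⟩ := quipuRoots_nonempty hm hk
  refine ⟨ρ, ⟨hρ, fun t ht => ?_⟩, hopen ρ hρ, fun hk2 r hr => ?_⟩
  -- The choice `r = 2` avoids the exceptional case for every `k`; two roots are both the spectral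
  -- radius of this graph, hence equal.
  · exact ((hopen t ht 2 (by omega) (by omega)).unique (hopen ρ hρ 2 (by omega) (by omega))).le
  · obtain ⟨x, hx, rfl⟩ := exists_eq_add_inv hρ.1
    exact isGraphSpectralRadius_specialClosedQuipu hk2 hr hx (powDiff_of_mem_quipuRoots hm hx hρ)
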